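/- Let $W=\{w_{i,j}: i,j\ge 1\}$ be an infinite array of independent $\mathcal N(0,1)$ random variables and, for $n\ge 1$, let $W_n=\{w_{i,j}:1\le i,j\le n\}$. For $A,B\subseteq\{1,\dots,n\}$ and the submatrix $U=\{w_{i,j}: i\in A,\ j\in B\}$ of $W_n$ (rows and columns need not be contiguous) let $$G(U)=\min\Big\{\frac{1}{(|A|-1)(|B|-1)}\sum_{i\in A,\,j\in B}(w_{i,j}-a_i-b_j-c)^2\Big\},$$ where the minimum is over all real constants $\{a_i:i\in A\}$, $\{b_j:j\in B\}$ and $c$ (with $G(U)=0$ if $|A|=1$ or $|B|=1$). For $0<\tau<1$ let $L_\tau(W_n)$ be the largest $k$ such that $W_n$ contains a $k\times k$ submatrix $U$ with $G(U)\le\tau$, and put $$h(\tau)=1-\tau-\ln(2-\tau),\qquad t(n,\tau)=\frac{4}{h(\tau)}\ln n-\frac{4}{h(\tau)}\ln\Big(\frac{4}{h(\tau)}\ln n\Big)+\frac{4}{h(\tau)}+2.$$ Let $0<\tau<1$ be fixed. For every $\epsilon>0$, when $n$ is sufficiently large (depending only on $\tau$ and $\epsilon$), $$P\big(L_\tau(W_n)\ge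 t(n,\tau)+r\big)\ \le\ \frac{4}{h(\tau)}\Big(\frac{\ln n}{h(\tau)}\Big)^{2r+2+\epsilon}n^{-2r}\qquad\text{for every } r=1,\dots,n.$$ -/

import Mathlib

open MeasureTheory ProbabilityTheory

/-- `W` is an infinite array of independent standard Gaussian random variables
(rows and columns are numbered from `0`). -/
structure IsGaussianArray {Ω : Type*} [MeasurableSpace Ω] (μ : Measure Ω)
    (W : ℕ → ℕ → Ω → ℝ) : Prop where
  hasLaw : ∀ i j, HasLaw (W i j) (gaussianReal 0 1) μ
  indep : iIndepFun (fun p : ℕ × ℕ => W p.1 p.2) μ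

/-- The `n × n` upper left-hand corner of the array `W`, at the outcome `ω`. -/
def cornerMatrix {Ω : Type*} (W : ℕ → ℕ → Ω → ℝ) (n : ℕ) (ω : Ω) :
    Matrix (Fin n) (Fin n) ℝ :=
  Matrix.of fun i j => W i j ω

/-- The ANOVA residual mean square `G(U)` of the submatrix `U` of `M` with rows `A` and
columns `B`: the minimum of
`(1 / ((|A| - 1) (|B| - 1))) * ∑ (M i j - a i - b j - c) ^ 2` over real constants `a i`, `b j`, `c`,
where `p = (a, b, c)`. Values of `a` off `A` and of `b` off `B` play no role. For
`|A| = 1` or `|B| = 1`, where the residual sum has minimum `0` as well, the value is `0`. -/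
noncomputable def anovaG {n : ℕ} (M : Matrix (Fin n) (Fin n) ℝ) (A B : Finset (Fin n)) : ℝ :=
  ⨅ p : (Fin n → ℝ) × (Fin n → ℝ) × ℝ,
    1 / (((A.card : ℝ) - 1) * ((B.card : ℝ) - 1)) *
      ∑ i ∈ A, ∑ j ∈ B, (M i j - p.1 i - p.2.1 j - p.2.2) ^ 2

/-- `L_τ(M)`: the largest `k` such that `M` contains a `k × k` submatrix `U` with `G(U) ≤ τ`.
Rows and columns need not be contiguous. The set is bounded by `n`. -/
noncomputable def anovaL {n : ℕ} (τ : ℝ) (M : Matrix (Fin n) (Fin n) ℝ) : ℕ :=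
  sSup {k : ℕ | ∃ A B : Finset (Fin n), A.card = k ∧ B.card = k ∧ anovaG M A B ≤ τ}

/-- `h(τ) = 1 - τ - log (2 - τ)`. -/
noncomputable def anovaH (τ : ℝ) : ℝ := 1 - τ - Real.log (2 - τ)

/-- The size threshold `t(n, τ)`. -/
noncomputable def anovaT (n : ℕ) (τ : ℝ) : ℝ :=
  4 / anovaH τ * Real.log n - 4 / anovaH τ * Real.log (4 / anovaH τ * Real.log n)
    + 4 / anovaH τ + 2

/-! Fix a `k × k` block, `k ≥ 2`. Tensor products of orthonormal row and column contrasts annihilate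
every additive fit, so the residual sum of squares dominates a chi-square variable with `(k - 1)^2`
degrees of freedom. Chernoff's bound gives `G ≤ τ` probability at most `exp (-(k - 1)^2 / 2 * H)`,
with `H = τ - 1 - log τ`.

There are at most `n^(2k)` such blocks. Since `H` strictly exceeds `anovaH τ`, for `k ≥ anovaT n τ +
r` the Chernoff exponent beats this crude count with a factor `n^(-(2r + 2))` to spare. A union
bound over blocks and sizes then gives `n^(-2r)`, and the remaining factor of the claimed bound is
at least `1` for large `n`. -/

/-! ### Gaussian vectors and the chi-square lower tail -/

/-- The moment generating function of the square of a standard Gaussian variable, on the left. -/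
theorem mgf_sq_gaussianReal {l : ℝ} (hl : 0 ≤ l) :
    mgf (fun x : ℝ => x ^ 2) (gaussianReal 0 1) (-l) = (√(1 + 2 * l))⁻¹ := by
  rw [mgf, integral_gaussianReal_eq_integral_smul one_ne_zero]
  have h : ∀ x : ℝ, gaussianPDFReal 0 1 x • Real.exp (-l * x ^ 2) =
      (√(2 * Real.pi))⁻¹ * Real.exp (-(1 / 2 + l) * x ^ 2) := by
    intro x
    simp only [gaussianPDFReal, NNReal.coe_one, mul_one, sub_zero, smul_eq_mul]
    rw [mul_assoc, ← Real.exp_add]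
    congr 2
    ring
  simp_rw [h]
  rw [integral_const_mul, integral_gaussian, ← Real.sqrt_inv, ← Real.sqrt_inv,
    ← Real.sqrt_mul (by positivity)]
  congr 1
  have := Real.pi_pos
  field_simp

/-- The combinations are jointly Gaussian with identity covariance, and for jointly Gaussian
variables uncorrelated means independent. -/
theorem iIndepFun_orthonormal_combination {Ω ι κ : Type*} [MeasurableSpace Ω] {μ : Measure Ω}
    [IsProbabilityMeasure μ] [Fintype ι] [Finite κ] [DecidableEq κ] {X : ι → Ω → ℝ}
    (hX : ∀ i, HasLaw (X i) (gaussianReal 0 1) μ) (hi : iIndepFun X μ) {e : κ → ι → ℝ}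
    (he : ∀ k l, ∑ i, e k i * e l i = if k = l then 1 else 0) :
    iIndepFun (fun k ω => ∑ i, e k i * X i ω) μ ∧
      ∀ k, HasLaw (fun ω => ∑ i, e k i * X i ω) (gaussianReal 0 1) μ := by
  classical
  have := Fintype.ofFinite κ
  have hg : HasGaussianLaw (fun ω i => X i ω) μ := hi.hasGaussianLaw fun i => (hX i).hasGaussianLaw
  let T : (ι → ℝ) →L[ℝ] (κ → ℝ) := LinearMap.toContinuousLinearMap
    (Matrix.toLin' (Matrix.of e))
  have hT : ∀ ω, T (fun i => X i ω) = fun k => ∑ i, e k i * X i ω := by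
    intro ω
    ext k
    simp [T, Matrix.mulVec, dotProduct]
  have hY : HasGaussianLaw (fun ω k => ∑ i, e k i * X i ω) μ := by
    simpa only [hT] using hg.map_fun T
  have h2 : ∀ i, MemLp (X i) 2 μ := fun i => (hX i).hasGaussianLaw.memLp_two
  have hcov : ∀ i j, cov[X i, X j; μ] = if i = j then 1 else 0 := by
    intro i j
    split_ifs with h
    · subst h
      rw [covariance_self (hX i).aemeasurable, (hX i).variance_eq]
      simp
    · exact (hi.indepFun h).covariance_eq_zero (h2 i) (h2 j)
  have hcovY : ∀ k l, cov[fun ω => ∑ i, e k i * X i ω, fun ω => ∑ i, e l i * X i ω; μ] =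
      if k = l then 1 else 0 := by
    intro k l
    rw [covariance_fun_sum_fun_sum (fun i => (h2 i).const_mul _) (fun i => (h2 i).const_mul _),
      ← he]
    simp_rw [covariance_const_mul_left, covariance_const_mul_right, hcov]
    simp
  refine ⟨hY.iIndepFun_of_covariance_eq_zero fun k l hkl => by simp [hcovY, hkl], fun k => ?_⟩
  have hk := hY.eval k
  refine ⟨hk.aemeasurable, ?_⟩
  rw [hk.map_eq_gaussianReal]
  have hm : μ[fun ω => ∑ i, e k i * X i ω] = 0 := by
    rw [integral_finsetSum _ fun i _ => ((hX i).hasGaussianLaw.integrable).const_mul _]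
    refine Finset.sum_eq_zero fun i _ => ?_
    rw [integral_const_mul, (hX i).integral_eq]
    simp
  have hv : Var[fun ω => ∑ i, e k i * X i ω; μ] = 1 := by
    rw [← covariance_self hk.aemeasurable, hcovY]
    simp
  rw [hm, hv]
  simp

/-- Chernoff's bound for the lower tail of the chi-square distribution. -/
theorem chiSquare_lower_tail {Ω κ : Type*} [MeasurableSpace Ω] {μ : Measure Ω}
    [IsProbabilityMeasure μ] [Fintype κ] {Y : κ → Ω → ℝ}
    (hY : ∀ i, HasLaw (Y i) (gaussianReal 0 1) μ) (hi : iIndepFun Y μ) {τ : ℝ} (hτ0 : 0 < τ)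
    (hτ1 : τ < 1) :
    μ.real {ω | ∑ k, Y k ω ^ 2 ≤ τ * Fintype.card κ} ≤
      Real.exp (-((Fintype.card κ : ℝ) / 2 * (τ - 1 - Real.log τ))) := by
  set m := Fintype.card κ
  -- The optimal Chernoff parameter: `1 + 2 * l = 1 / τ` minimises `exp (l * τ * m) * (1 + 2 * l) ^
  -- (-m / 2)`.
  set l : ℝ := (1 / τ - 1) / 2 with hl
  have hl0 : 0 ≤ l := by
    have : 1 ≤ 1 / τ := by rw [le_div_iff₀ hτ0]; linarith
    linarith
  have hsq : iIndepFun (fun k ω => Y k ω ^ 2) μ :=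
    hi.comp (fun _ x => x ^ 2) fun _ => by fun_prop
  have hmeas : ∀ k, AEMeasurable (fun ω => Y k ω ^ 2) μ := fun k => (hY k).aemeasurable.pow_const 2
  have hmgf : mgf (fun ω => ∑ k, Y k ω ^ 2) μ (-l) = (√τ) ^ m := by
    have h1 := hsq.mgf_sum₀ (t := -l) hmeas Finset.univ
    have h2 : (∑ k, fun ω => Y k ω ^ 2) = fun ω => ∑ k, Y k ω ^ 2 := by ext; simp
    rw [h2] at h1
    have h3 : ∀ k, mgf (fun ω => Y k ω ^ 2) μ (-l) = √τ := by
      intro k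
      have h4 := mgf_map (hY k).aemeasurable (X := fun x : ℝ => x ^ 2) (t := -l) (by fun_prop)
      rw [(hY k).map_eq, mgf_sq_gaussianReal hl0] at h4
      have h5 : (fun ω => Y k ω ^ 2) = (fun x : ℝ => x ^ 2) ∘ Y k := rfl
      rw [h5, ← h4, ← Real.sqrt_inv]
      congr 1
      rw [hl]
      field_simp
      ring
    simpa [h3, m] using h1
  have hint : Integrable (fun ω => Real.exp (-l * ∑ k, Y k ω ^ 2)) μ := by
    refine Integrable.of_bound (C := 1) ?_ (Filter.Eventually.of_forall fun ω => ?_)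
    · exact (Real.measurable_exp.comp_aemeasurable
        ((Finset.univ.aemeasurable_fun_sum fun k _ => hmeas k).const_mul _)).aestronglyMeasurable
    · rw [Real.norm_eq_abs, Real.abs_exp]
      refine Real.exp_le_one_iff.2 ?_
      have : 0 ≤ ∑ k, Y k ω ^ 2 := Finset.sum_nonneg fun k _ => sq_nonneg _
      nlinarith
  refine (measure_le_le_exp_mul_mgf (t := -l) (τ * m) (by linarith) hint).trans ?_
  rw [hmgf]
  have h6 : √τ = Real.exp (Real.log τ / 2) := by
    rw [← Real.log_sqrt hτ0.le, Real.exp_log (Real.sqrt_pos.2 hτ0)]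
  rw [h6, ← Real.exp_nat_mul, ← Real.exp_add]
  refine Real.exp_le_exp.2 (le_of_eq ?_)
  rw [hl]
  field_simp
  ring

/-! ### Orthonormal families and contrasts -/

/-- Bessel's inequality in coordinates. -/
theorem sum_sq_coeff_le {ι κ : Type*} [Fintype ι] [Fintype κ] [DecidableEq κ] {e : κ → ι → ℝ}
    (he : ∀ k l, ∑ i, e k i * e l i = if k = l then 1 else 0) (x : ι → ℝ) :
    ∑ k, (∑ i, e k i * x i) ^ 2 ≤ ∑ i, x i ^ 2 := by
  have ho : Orthonormal ℝ fun k => (WithLp.toLp 2 (e k) : EuclideanSpace ℝ ι) := by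
    rw [orthonormal_iff_ite]
    intro k l
    rw [← he]
    simp [PiLp.inner_apply, mul_comm]
  have h := ho.sum_inner_products_le (x := (WithLp.toLp 2 x : EuclideanSpace ℝ ι))
    (s := Finset.univ)
  simpa [PiLp.inner_apply, EuclideanSpace.norm_sq_eq, mul_comm] using h

/-- An orthonormal basis of contrasts. -/
theorem exists_orthonormal_contrasts (ι : Type*) [Fintype ι] {k : ℕ} (hk : Fintype.card ι = k + 1) :
    ∃ u : Fin k → ι → ℝ, (∀ a, ∑ i, u a i = 0) ∧
      ∀ a b, ∑ i, u a i * u b i = if a = b then 1 else 0 := by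
  -- Contrasts are the vectors orthogonal to the all-ones vector.
  let o : EuclideanSpace ℝ ι := WithLp.toLp 2 fun _ => 1
  have ho : o ≠ 0 := by
    have : Nonempty ι := Fintype.card_pos_iff.1 (by omega)
    intro h
    have := congrArg (fun v : EuclideanSpace ℝ ι => v (Classical.arbitrary ι)) h
    simp [o] at this
  have : Fact (Module.finrank ℝ (EuclideanSpace ℝ ι) = k + 1) := ⟨by simpa using hk⟩
  let b := OrthonormalBasis.fromOrthogonalSpanSingleton (𝕜 := ℝ) k ho
  refine ⟨fun a => (b a : EuclideanSpace ℝ ι), fun a => ?_, fun a c => ?_⟩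
  · have h := Submodule.mem_orthogonal_singleton_iff_inner_right.1 (b a).2
    simpa [PiLp.inner_apply, o] using h
  · have h := orthonormal_iff_ite.1 b.orthonormal a c
    rw [← h, Submodule.coe_inner]
    simp [PiLp.inner_apply, mul_comm]

/-! ### Comparison of rates and the size threshold -/

theorem anovaH_pos {τ : ℝ} (hτ1 : τ < 1) : 0 < anovaH τ := by
  have := Real.log_lt_sub_one_of_pos (x := 2 - τ) (by linarith) (by linarith)
  unfold anovaH
  linarith

theorem anovaH_lt_one {τ : ℝ} (hτ0 : 0 < τ) (hτ1 : τ < 1) : anovaH τ < 1 := by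
  have := Real.log_pos (x := 2 - τ) (by linarith)
  unfold anovaH
  linarith

/-- The rate `anovaH` is strictly smaller than the Chernoff rate of the lower tail. -/
theorem anovaH_lt {τ : ℝ} (hτ0 : 0 < τ) (hτ1 : τ < 1) : anovaH τ < τ - 1 - Real.log τ := by
  have hx : |1 - τ| < 1 := by rw [abs_lt]; constructor <;> linarith
  -- With `x = 1 - τ`, the difference of the rates is `log (1 + x) - log (1 - x) - 2 * x`. The first
  -- two terms of the series of positive terms bound it below by `2 * x ^ 3 / 3`.
  have h := sum_le_hasSum (Finset.range 2)
    (fun i _ => by have : 0 < 1 - τ := by linarith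
                   positivity) (Real.hasSum_log_sub_log_of_abs_lt_one hx)
  have h3 : 0 < (1 - τ) ^ 3 := pow_pos (by linarith) 3
  norm_num [Finset.sum_range_succ] at h
  rw [show 1 + (1 - τ) = 2 - τ by ring] at h
  unfold anovaH
  linarith

open Filter in
-- The correction to the leading term of `anovaT` is of order `log (log n)`, so any smaller slope
-- absorbs it. The `- 1` serves the later use of `k - 1`.
theorem eventually_mul_log_le_anovaT {τ c : ℝ} (hτ1 : τ < 1) (hc : c < 4 / anovaH τ) :
    ∀ᶠ n : ℕ in atTop, c * Real.log n ≤ anovaT n τ - 1 := by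
  have hh := anovaH_pos hτ1
  set q := 4 / anovaH τ with hq
  have hq0 : 0 < q := by positivity
  have hx : Tendsto (fun n : ℕ => q * Real.log n) atTop atTop :=
    (Real.tendsto_log_atTop.comp tendsto_natCast_atTop_atTop).const_mul_atTop hq0
  have ho := hx.eventually
    (Real.isLittleO_log_id_atTop.bound (c := (q - c) / q ^ 2) (by
      have : 0 < q - c := by linarith
      positivity))
  filter_upwards [ho, hx.eventually_ge_atTop 0] with n hn hn0
  rw [id, Real.norm_eq_abs, Real.norm_eq_abs, abs_of_nonneg hn0] at hn
  have h1 := mul_le_mul_of_nonneg_left ((le_abs_self _).trans hn) hq0.le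
  have h2 : q * ((q - c) / q ^ 2 * (q * Real.log n)) = (q - c) * Real.log n := by
    field_simp
  rw [h2] at h1
  unfold anovaT
  rw [← hq]
  linarith

/-- For large `n`, the Chernoff exponent beats the entropy of the choice of a submatrix. -/
theorem eventually_exponent_le {τ : ℝ} (hτ0 : 0 < τ) (hτ1 : τ < 1) :
    ∃ N : ℕ, ∀ n : ℕ, N ≤ n → ∀ r k : ℕ, anovaT n τ + r ≤ k → 2 ≤ k ∧
      2 * k * Real.log n - ((k : ℝ) - 1) ^ 2 / 2 * (τ - 1 - Real.log τ) ≤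
        -(2 * r + 2) * Real.log n := by
  have hh := anovaH_pos hτ1
  have hlt := anovaH_lt hτ0 hτ1
  set H := τ - 1 - Real.log τ with hH
  have hH0 : 0 < H := hh.trans hlt
  -- Half of the relative gap between the rates: the slope `4 / H * (1 + d)` stays below `4 / anovaH
  -- τ` yet exceeds the critical `4 / H`.
  set d := (H / anovaH τ - 1) / 2 with hd
  have hd0 : 0 < d := by
    have : 1 < H / anovaH τ := by rwa [lt_div_iff₀ hh, one_mul]
    linarith
  have hc : 4 / H * (1 + d) < 4 / anovaH τ := by
    have h1 : 1 + d < H / anovaH τ := by linarith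
    calc 4 / H * (1 + d) < 4 / H * (H / anovaH τ) := by gcongr
      _ = 4 / anovaH τ := by field_simp
  have hx : Filter.Tendsto (fun n : ℕ => 4 / H * (1 + d) * Real.log n) Filter.atTop Filter.atTop :=
    (Real.tendsto_log_atTop.comp tendsto_natCast_atTop_atTop).const_mul_atTop (by positivity)
  obtain ⟨N, hN⟩ := Filter.eventually_atTop.1 ((eventually_mul_log_le_anovaT hτ1 hc).and
    (hx.eventually_ge_atTop (max 1 (2 / d))))
  refine ⟨N, fun n hn r k hk => ?_⟩
  obtain ⟨h1, h2⟩ := hN n hn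
  set L := Real.log n
  have hL : 0 ≤ L := Real.log_natCast_nonneg n
  have hr : (0 : ℝ) ≤ r := by positivity
  obtain ⟨h3, h4⟩ := max_le_iff.1 h2
  have hk1 : 4 / H * (1 + d) * L + r ≤ (k : ℝ) - 1 := by linarith
  have hk2 : (1 : ℝ) ≤ (k : ℝ) - 1 := by linarith
  refine ⟨by
    have : (2 : ℝ) ≤ k := by linarith
    exact_mod_cast this, ?_⟩
  set x := (k : ℝ) - 1 with hxk
  have h5 : 2 * (1 + d) * L + r * H / 2 ≤ x * H / 2 := by
    have := mul_le_mul_of_nonneg_right hk1 (by positivity : 0 ≤ H / 2)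
    have h6 : (4 / H * (1 + d) * L + r) * (H / 2) = 2 * (1 + d) * L + r * H / 2 := by
      field_simp
      ring
    linarith
  have h7 : x * (2 * (1 + d) * L + r * H / 2) ≤ x * (x * H / 2) :=
    mul_le_mul_of_nonneg_left h5 (by linarith)
  have h8 : 2 * L ≤ x * H / 2 := by nlinarith [mul_nonneg hd0.le hL, mul_nonneg hr hH0.le]
  have h9 : r * (2 * L) ≤ r * (x * H / 2) := mul_le_mul_of_nonneg_left h8 hr
  -- The gain `2 * d * x * L` from the gap must pay `4 * L`: half for replacing `k` by `k - 1` in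
  -- the entropy, half for the extra `n^(-2)`.
  have h10 : 2 ≤ d * x := by
    rw [div_le_iff₀ hd0] at h4
    nlinarith
  have h11 : 2 * L ≤ d * x * L := mul_le_mul_of_nonneg_right h10 hL
  have h12 : (k : ℝ) = x + 1 := by simp [hxk]
  rw [h12]
  nlinarith

/-! ### The residual sum of squares of a fixed block -/

theorem orthonormal_tensor {α β : Type*} [Fintype α] [Fintype β] {k l : ℕ} {u : Fin k → α → ℝ}
    {v : Fin l → β → ℝ} (hu : ∀ a b, ∑ i, u a i * u b i = if a = b then 1 else 0)
    (hv : ∀ a b, ∑ i, v a i * v b i = if a = b then 1 else 0) (a b : Fin k × Fin l) :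
    ∑ p : α × β, u a.1 p.1 * v a.2 p.2 * (u b.1 p.1 * v b.2 p.2) = if a = b then 1 else 0 := by
  have h : ∀ p : α × β, u a.1 p.1 * v a.2 p.2 * (u b.1 p.1 * v b.2 p.2) =
      u a.1 p.1 * u b.1 p.1 * (v a.2 p.2 * v b.2 p.2) := fun p => by ring
  simp_rw [h]
  rw [Fintype.sum_prod_type]
  dsimp only
  rw [← Fintype.sum_mul_sum, hu, hv]
  by_cases h1 : a.1 = b.1 <;> by_cases h2 : a.2 = b.2 <;> simp [h1, h2, Prod.ext_iff]

/-- The tensor products of two families of contrasts bound the residual sum of squares from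
below. -/
theorem sum_sq_contrast_le {α β : Type*} [Fintype α] [Fintype β] {k l : ℕ} {u : Fin k → α → ℝ}
    {v : Fin l → β → ℝ} (hu0 : ∀ a, ∑ i, u a i = 0)
    (hu : ∀ a b, ∑ i, u a i * u b i = if a = b then 1 else 0) (hv0 : ∀ a, ∑ i, v a i = 0)
    (hv : ∀ a b, ∑ i, v a i * v b i = if a = b then 1 else 0) (x : α × β → ℝ) (f : α → ℝ)
    (g : β → ℝ) :
    ∑ a : Fin k × Fin l, (∑ p : α × β, u a.1 p.1 * v a.2 p.2 * x p) ^ 2 ≤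
      ∑ p : α × β, (x p - f p.1 - g p.2) ^ 2 := by
  refine le_trans (le_of_eq ?_) (sum_sq_coeff_le (orthonormal_tensor hu hv) _)
  refine Finset.sum_congr rfl fun a _ => ?_
  congr 1
  -- A row effect is killed by the column contrast, and a column effect by the row contrast.
  have hf : ∑ p : α × β, u a.1 p.1 * f p.1 * v a.2 p.2 = 0 := by
    rw [Fintype.sum_prod_type]
    simp_rw [← Finset.mul_sum, hv0, mul_zero, Finset.sum_const_zero]
  have hg : ∑ p : α × β, u a.1 p.1 * (v a.2 p.2 * g p.2) = 0 := by
    rw [Fintype.sum_prod_type]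
    dsimp only
    rw [← Fintype.sum_mul_sum, hu0, zero_mul]
  rw [← sub_zero (∑ p : α × β, u a.1 p.1 * v a.2 p.2 * x p), ← hf, ← Finset.sum_sub_distrib,
    ← sub_zero (∑ p : α × β, _), ← hg, ← Finset.sum_sub_distrib]
  exact Finset.sum_congr rfl fun p _ => by ring

theorem measureReal_anovaG_le {Ω : Type*} [MeasurableSpace Ω] {μ : Measure Ω}
    [IsProbabilityMeasure μ] {W : ℕ → ℕ → Ω → ℝ} (hW : IsGaussianArray μ W) {τ : ℝ} (hτ0 : 0 < τ)
    (hτ1 : τ < 1) {n k : ℕ} (hk : 2 ≤ k) {A B : Finset (Fin n)} (hA : A.card = k)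
    (hB : B.card = k) :
    μ.real {ω | anovaG (cornerMatrix W n ω) A B ≤ τ} ≤
      Real.exp (-(((k : ℝ) - 1) ^ 2 / 2 * (τ - 1 - Real.log τ))) := by
  obtain ⟨m, rfl⟩ : ∃ m, k = m + 1 := ⟨k - 1, by omega⟩
  obtain ⟨u, hu0, hu⟩ := exists_orthonormal_contrasts A (k := m) (by simpa using hA)
  obtain ⟨v, hv0, hv⟩ := exists_orthonormal_contrasts B (k := m) (by simpa using hB)
  let X : A × B → Ω → ℝ := fun p => W (p.1 : Fin n) (p.2 : Fin n)
  have hX : ∀ p, HasLaw (X p) (gaussianReal 0 1) μ := fun p => hW.hasLaw _ _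
  have hXi : iIndepFun X μ := by
    refine hW.indep.precomp (g := fun p : A × B => (((p.1 : Fin n) : ℕ), ((p.2 : Fin n) : ℕ))) ?_
    rintro ⟨a, b⟩ ⟨c, d⟩ h
    obtain ⟨h1, h2⟩ := Prod.ext_iff.1 h
    exact Prod.ext (Subtype.ext (Fin.ext h1)) (Subtype.ext (Fin.ext h2))
  obtain ⟨hYi, hY⟩ := iIndepFun_orthonormal_combination hX hXi (orthonormal_tensor hu hv)
  have h := chiSquare_lower_tail hY hYi hτ0 hτ1
  have hm : (0 : ℝ) < m := by
    have : 0 < m := by omega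
    exact_mod_cast this
  simp only [Fintype.card_prod, Fintype.card_fin, Nat.cast_mul] at h
  refine le_trans (measureReal_mono fun ω hω => ?_) (h.trans (le_of_eq (by push_cast; ring_nf)))
  refine le_of_mul_le_mul_left (a := 1 / ((m : ℝ) * m)) (le_trans ?_ (hω.trans (le_of_eq ?_)))
    (by positivity)
  -- The chi-square bound holds for every choice of constants, so it passes to the infimum without a
  -- minimiser; the constant `c` is absorbed into the column effects.
  · refine le_ciInf fun p => ?_
    rw [hA, hB]
    push_cast
    rw [add_sub_cancel_right]
    refine mul_le_mul_of_nonneg_left ?_ (by positivity)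
    refine (sum_sq_contrast_le hu0 hu hv0 hv (fun q => X q ω) (fun i => p.1 i)
      (fun j => p.2.1 j + p.2.2)).trans (le_of_eq ?_)
    rw [Fintype.sum_prod_type, ← Finset.sum_coe_sort A]
    refine Finset.sum_congr rfl fun i _ => ?_
    rw [← Finset.sum_coe_sort B]
    refine Finset.sum_congr rfl fun j _ => ?_
    simp only [X, cornerMatrix, Matrix.of_apply]
    ring
  · field_simp

/-! ### The union bound -/

theorem exists_anovaG_le_of_anovaL {n : ℕ} (τ : ℝ) (M : Matrix (Fin n) (Fin n) ℝ) (hτ : 0 ≤ τ) :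
    ∃ A B : Finset (Fin n), A.card = anovaL τ M ∧ B.card = anovaL τ M ∧ anovaG M A B ≤ τ := by
  -- The empty block, with `anovaG` equal to `0`, makes the set nonempty, so the supremum is
  -- attained.
  refine Nat.sSup_mem (s := {k : ℕ | ∃ A B : Finset (Fin n),
    A.card = k ∧ B.card = k ∧ anovaG M A B ≤ τ}) ⟨0, ∅, ∅, rfl, rfl, ?_⟩ ⟨n, ?_⟩
  · simpa [anovaG] using hτ
  · rintro k ⟨A, -, rfl, -⟩
    simpa using A.card_le_univ

theorem proposition2 (τ : ℝ) (hτ0 : 0 < τ) (hτ1 : τ < 1) (ε : ℝ) (hε : 0 < ε) :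
    ∃ N : ℕ, ∀ (Ω : Type*) [MeasurableSpace Ω] (μ : Measure Ω) [IsProbabilityMeasure μ]
      (W : ℕ → ℕ → Ω → ℝ), IsGaussianArray μ W →
      ∀ n : ℕ, N ≤ n → ∀ r : ℕ, 1 ≤ r → r ≤ n →
        μ.real {ω | anovaT n τ + (r : ℝ) ≤ (anovaL τ (cornerMatrix W n ω) : ℝ)} ≤
          4 / anovaH τ * (Real.log n / anovaH τ) ^ (2 * (r : ℝ) + 2 + ε) *
            (n : ℝ) ^ (-(2 * (r : ℝ))) := by
  have hh := anovaH_pos hτ1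
  obtain ⟨N₁, hN₁⟩ := eventually_exponent_le hτ0 hτ1
  obtain ⟨N₂, hN₂⟩ := Filter.eventually_atTop.1
    ((Real.tendsto_log_atTop.comp tendsto_natCast_atTop_atTop).eventually_ge_atTop (anovaH τ))
  refine ⟨max 2 (max N₁ N₂), fun Ω _ μ _ W hW n hn r _ _ => ?_⟩
  obtain ⟨hn2, hn3⟩ := max_le_iff.1 hn
  obtain ⟨hn1, hn4⟩ := max_le_iff.1 hn3
  have hlog : anovaH τ ≤ Real.log n := hN₂ n hn4
  have hn0 : (0 : ℝ) < n := by
    have : 0 < n := by omega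
    exact_mod_cast this
  have hn2' : (2 : ℝ) ≤ n := by exact_mod_cast hn2
  set c : ℝ := (n : ℝ) ^ (-(2 * (r : ℝ))) with hc
  have hc0 : 0 < c := Real.rpow_pos_of_pos hn0 _
  -- As `anovaH τ < 1` and `log n ≥ anovaH τ`, the prefactor is at least `1`, so bounding the
  -- probability by `c` suffices.
  have hrhs : c ≤ 4 / anovaH τ * (Real.log n / anovaH τ) ^ (2 * (r : ℝ) + 2 + ε) * c := by
    refine le_mul_of_one_le_left hc0.le (one_le_mul_of_one_le_of_one_le ?_
      (Real.one_le_rpow ?_ (by positivity)))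
    · rw [one_le_div hh]
      linarith [anovaH_lt_one hτ0 hτ1]
    · rwa [one_le_div hh]
  refine le_trans ?_ hrhs
  classical
  let S : Finset ℕ := (Finset.range (n + 1)).filter fun k => anovaT n τ + r ≤ k
  let Q : ℕ → Finset (Finset (Fin n) × Finset (Fin n)) := fun k =>
    Finset.univ.powersetCard k ×ˢ Finset.univ.powersetCard k
  have hsub : {ω | anovaT n τ + (r : ℝ) ≤ (anovaL τ (cornerMatrix W n ω) : ℝ)} ⊆
      ⋃ k ∈ S, ⋃ p ∈ Q k, {ω | anovaG (cornerMatrix W n ω) p.1 p.2 ≤ τ} := by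
    intro ω hω
    obtain ⟨A, B, hA, hB, hG⟩ := exists_anovaG_le_of_anovaL τ (cornerMatrix W n ω) hτ0.le
    simp only [Set.mem_iUnion]
    refine ⟨anovaL τ (cornerMatrix W n ω), ?_, (A, B), ?_, hG⟩
    · refine Finset.mem_filter.2 ⟨Finset.mem_range.2 (Nat.lt_succ_of_le ?_), hω⟩
      rw [← hA]
      simpa using A.card_le_univ
    · simp [Q, Finset.mem_powersetCard, hA, hB]
  -- The factor `n^(-2)` pays for the sum over at most `n + 1 ≤ n^2` sizes.
  have hterm : ∀ k ∈ S, μ.real (⋃ p ∈ Q k, {ω | anovaG (cornerMatrix W n ω) p.1 p.2 ≤ τ}) ≤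
      c / (n : ℝ) ^ 2 := by
    intro k hkS
    obtain ⟨hk2, hk⟩ := hN₁ n hn1 r k (Finset.mem_filter.1 hkS).2
    set E := ((k : ℝ) - 1) ^ 2 / 2 * (τ - 1 - Real.log τ) with hE
    have h1 : ∀ p ∈ Q k, μ.real {ω | anovaG (cornerMatrix W n ω) p.1 p.2 ≤ τ} ≤
        Real.exp (-E) := by
      intro p hp
      obtain ⟨hpA, hpB⟩ := Finset.mem_product.1 hp
      exact measureReal_anovaG_le hW hτ0 hτ1 hk2 (Finset.mem_powersetCard.1 hpA).2
        (Finset.mem_powersetCard.1 hpB).2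
    have hcard : ((Q k).card : ℝ) ≤ Real.exp (2 * k * Real.log n) := by
      have h2 : (Q k).card ≤ n ^ k * n ^ k := by
        simp only [Q, Finset.card_product, Finset.card_powersetCard, Finset.card_univ,
          Fintype.card_fin]
        exact Nat.mul_le_mul (Nat.choose_le_pow n k) (Nat.choose_le_pow n k)
      have h3 : Real.exp (2 * k * Real.log n) = (n : ℝ) ^ k * (n : ℝ) ^ k := by
        rw [mul_assoc, two_mul, Real.exp_add, Real.exp_nat_mul, Real.exp_log hn0]
      rw [h3]
      exact_mod_cast h2
    have hcn : c / (n : ℝ) ^ 2 = Real.exp (-(2 * r + 2) * Real.log n) := by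
      rw [hc, ← Real.rpow_natCast, ← Real.rpow_sub hn0, Real.rpow_def_of_pos hn0]
      congr 1
      push_cast
      ring
    calc _ ≤ ∑ p ∈ Q k, μ.real {ω | anovaG (cornerMatrix W n ω) p.1 p.2 ≤ τ} :=
          measureReal_biUnion_finset_le _ _
      _ ≤ (Q k).card * Real.exp (-E) := by
          simpa using Finset.sum_le_sum h1
      _ ≤ Real.exp (2 * k * Real.log n) * Real.exp (-E) := by gcongr
      _ ≤ c / (n : ℝ) ^ 2 := by
          rw [hcn, ← Real.exp_add, ← sub_eq_add_neg]
          exact Real.exp_le_exp.2 hk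
  calc _ ≤ μ.real (⋃ k ∈ S, ⋃ p ∈ Q k, {ω | anovaG (cornerMatrix W n ω) p.1 p.2 ≤ τ}) :=
        measureReal_mono hsub (measure_ne_top _ _)
    _ ≤ ∑ k ∈ S, μ.real (⋃ p ∈ Q k, {ω | anovaG (cornerMatrix W n ω) p.1 p.2 ≤ τ}) :=
        measureReal_biUnion_finset_le _ _
    _ ≤ S.card * (c / (n : ℝ) ^ 2) := by simpa using Finset.sum_le_sum hterm
    _ ≤ (n + 1) * (c / (n : ℝ) ^ 2) := by
        have : S.card ≤ n + 1 := (Finset.card_filter_le _ _).trans (by simp)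
        have : (S.card : ℝ) ≤ n + 1 := by exact_mod_cast this
        gcongr
    _ ≤ (n : ℝ) ^ 2 * (c / (n : ℝ) ^ 2) := by
        gcongr
        nlinarith
    _ = c := by field_simp
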